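/- Let $K$ be an infinite field of characteristic different from $2$ and $3$; all algebras are associative with $1$. Let $F$ be the free associative $K$-algebra on $x_1,x_2,\dots$. Put $[a,b]=ab-ba$ and $[a_1,\dots,a_n]=[[a_1,\dots,a_{n-1}],a_n]$. Let $T^{(n)}$ be the T-ideal of $F$ generated by $[x_1,\dots,x_n]$, that is, the smallest two-sided ideal that contains this commutator and is stable under all $K$-algebra endomorphisms of $F$. Let $F^{(n)}=F/T^{(n)}$, let $F_r^{(n)}$ be the subalgebra of $F^{(n)}$ generated by the images of $x_1,\dots,x_r$, and let $Z(A)$ denote the center of an algebra $A$. (1) For every $n\ge 3$, $$Z(F_2^{(n)})=F_2^{(n)}\cap Z(F^{(n)}).$$ (2) The analogous equality fails for rank $3$ when $n=3$: $Z(F_3^{(3)})\neq F_3^{(3)}\cap Z(F^{(3)})$. More precisely, the element $[x_1,x_2]x_3$ belongs to $Z(F_3^{(3)})$ but not to $Z(F^{(3)})$. -/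

import Mathlib

/-- The left-normed commutator `[a 0, a 1, …, a (n - 1)]` of length `n`:
`[a 0, a 1] = a 0 * a 1 - a 1 * a 0` and
`[a 0, …, a k] = [[a 0, …, a (k - 1)], a k]`. (The value for `n = 0` is a convention.) -/
def leftNormedCommutator {A : Type*} [Ring A] (a : ℕ → A) : ℕ → A
  | 0 => 0
  | 1 => a 0
  | k + 2 =>
      leftNormedCommutator a (k + 1) * a (k + 1) - a (k + 1) * leftNormedCommutator a (k + 1)

/-- A T-ideal of a unital associative `K`-algebra: a two-sided ideal that is stable under all
(unital) algebra endomorphisms. -/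
def IsTIdeal (K : Type*) [CommRing K] {A : Type*} [Ring A] [Algebra K A]
    (I : TwoSidedIdeal A) : Prop :=
  ∀ φ : A →ₐ[K] A, ∀ f ∈ I, φ f ∈ I

/-- The T-ideal generated by a set: the smallest T-ideal containing it. -/
def tIdealSpan (K : Type*) [CommRing K] {A : Type*} [Ring A] [Algebra K A]
    (S : Set A) : TwoSidedIdeal A :=
  sInf {I : TwoSidedIdeal A | S ⊆ (I : Set A) ∧ IsTIdeal K I}

/-- The T-ideal `T^(n)` of the free unital associative algebra on countably many generators,
generated by the commutator `[x_1, …, x_n]` of free generators (indexed here from `0`). -/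
def lieNilpotentTIdeal (K : Type*) [CommRing K] (n : ℕ) : TwoSidedIdeal (FreeAlgebra K ℕ) :=
  tIdealSpan K {leftNormedCommutator (FreeAlgebra.ι K) n}

/-- The relatively free algebra `F^(n) = F / T^(n)` of countable rank with the identity
`[x_1, …, x_n] = 0`. -/
abbrev RelFree (K : Type*) [CommRing K] (n : ℕ) : Type _ :=
  (lieNilpotentTIdeal K n).ringCon.Quotient

/-- The image in `F^(n)` of the free generator with index `i`. -/
def relFreeGen (K : Type*) [CommRing K] (n : ℕ) (i : ℕ) : RelFree K n :=
  ((FreeAlgebra.ι K i : FreeAlgebra K ℕ) : (lieNilpotentTIdeal K n).ringCon.Quotient)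

/-- The rank `r` subalgebra `F_r^(n)` of `F^(n)`, generated by the first `r` generators. -/
def relFreeRank (K : Type*) [CommRing K] (n r : ℕ) : Subalgebra K (RelFree K n) :=
  Algebra.adjoin K (relFreeGen K n '' {i | i < r})

/-- The centre of a subalgebra `B` of `A`, regarded as a subalgebra of `A`. -/
def centerIn {K A : Type*} [CommRing K] [Ring A] [Algebra K A] (B : Subalgebra K A) :
    Subalgebra K A :=
  (Subalgebra.center K B).map B.val

/-! Lift a central element of $F_2^{(n)}$ to a polynomial `f` in two variables and put $k=n-1$; the
claim is $[f,z]\in T^{(k+1)}$ for every $z$. Let $W_j$ be spanned by products of commutators of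
generators of total weight at least $j$, where length $m+1$ means weight $m$. Since
$T^{(k+1)}\subseteq W_k$ (`map_mem_weightSpan`), $[f,x_i]\in W_k$ for both generators.

Make the generators primitive and write $\Delta f=\sum_u u\otimes f_u$ over words $u$. Then
$[f,z]=\sum_{u\ne 1}\mathrm{ad}_u(z)\,f_u$ (`bracket_eq_sum_adWord`), and two facts finish the
proof. (a) $f_u\in W_{k-|u|}$ for $u\neq 1$ (`coeff_wordCoproduct_mem_of_bracket_mem`): bracket `f`
with a long $[t,s,\dots,s]$ and read off the coefficient at $u\,t\,s^N$. (b) For a subalgebra $S$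
with two generators, $[a,g_1,\dots,g_p]\,[c,d_1,\dots,d_q]$ with $g_i,c,d_i\in S$ lies in the left
ideal generated by brackets $[a',g_1',\dots,g_{p+q}']$ with $g_i'\in S$
(`bracketProduct_adjoin_pair`): the obstruction is alternating in three entries and its vanishing
passes from generators to products, so two generators leave no room for it. Hence every summand of
$[f,z]$ lies in $T^{(k+1)}$.

In rank three with $n=3$, the identity $[a,b][c,b]=0$ makes $[x_1,x_2]x_3$ commute with
$x_1,x_2,x_3$, while in the exterior algebra on four vectors its bracket with a fourth variable
becomes $4e_0e_1e_2e_3\ne 0$. -/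

/-! ### Brackets with elements of a subring and the left ideals they generate -/

section BracketFiltration

variable {A : Type*} [Ring A]

/-- The additive span of the iterated brackets `[l, g₁, …, g_k]` with `l ∈ L` and `gᵢ ∈ S`. -/
def bracketPower (S : Subring A) (L : AddSubgroup A) : ℕ → AddSubgroup A
  | 0 => L
  | k + 1 => AddSubgroup.closure {x | ∃ b ∈ bracketPower S L k, ∃ g ∈ S, x = ⁅b, g⁆}

/-- The left ideal generated by the brackets `[a, g₁, …, g_k]` with `a` arbitrary, `gᵢ ∈ S`. -/
def bracketIdeal (S : Subring A) (k : ℕ) : Ideal A :=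
  Ideal.span (bracketPower S ⊤ k : Set A)

theorem bracket_add_left (a b c : A) : ⁅a + b, c⁆ = ⁅a, c⁆ + ⁅b, c⁆ := by
  simp only [Ring.lie_def]; noncomm_ring

theorem bracket_add_right (a b c : A) : ⁅a, b + c⁆ = ⁅a, b⁆ + ⁅a, c⁆ := by
  simp only [Ring.lie_def]; noncomm_ring

theorem bracket_neg_left (a b : A) : ⁅-a, b⁆ = -⁅a, b⁆ := by
  simp only [Ring.lie_def]; noncomm_ring

/-- The iterated bracket `[x, d₁, …, d_r]`. -/
def iterBracket (x : A) (ds : List A) : A := ds.foldl (fun y d => ⁅y, d⁆) x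

@[simp] theorem iterBracket_nil (x : A) : iterBracket x [] = x := rfl

@[simp] theorem iterBracket_cons (x d : A) (ds : List A) :
    iterBracket x (d :: ds) = iterBracket ⁅x, d⁆ ds := rfl

theorem iterBracket_append (x : A) (ds es : List A) :
    iterBracket x (ds ++ es) = iterBracket (iterBracket x ds) es :=
  List.foldl_append

theorem iterBracket_add (x y : A) (ds : List A) :
    iterBracket (x + y) ds = iterBracket x ds + iterBracket y ds := by
  induction ds generalizing x y with
  | nil => rfl
  | cons d ds ih => simp [bracket_add_left, ih]

theorem iterBracket_neg (x : A) (ds : List A) : iterBracket (-x) ds = -iterBracket x ds := by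
  induction ds generalizing x with
  | nil => rfl
  | cons d ds ih => simp [bracket_neg_left, ih]

theorem mul_bracket (a b c : A) : ⁅a * b, c⁆ = a * ⁅b, c⁆ + ⁅a, c⁆ * b := by
  simp only [Ring.lie_def]; noncomm_ring

theorem bracket_mul (a b c : A) : ⁅a, b * c⁆ = ⁅a, b⁆ * c + b * ⁅a, c⁆ := by
  simp only [Ring.lie_def]; noncomm_ring

theorem bracket_bracket (a b c : A) : ⁅a, ⁅b, c⁆⁆ = ⁅⁅a, b⁆, c⁆ - ⁅⁅a, c⁆, b⁆ := by
  simp only [Ring.lie_def]; noncomm_ring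

variable {S : Subring A} {L : AddSubgroup A}

theorem bracket_mem_subring {a b : A} (ha : a ∈ S) (hb : b ∈ S) : ⁅a, b⁆ ∈ S := by
  rw [Ring.lie_def]
  exact S.sub_mem (S.mul_mem ha hb) (S.mul_mem hb ha)

theorem bracketPower_succ_mem {k : ℕ} {b g : A} (hb : b ∈ bracketPower S L k) (hg : g ∈ S) :
    ⁅b, g⁆ ∈ bracketPower S L (k + 1) :=
  AddSubgroup.subset_closure ⟨b, hb, g, hg, rfl⟩

theorem iterBracket_mem {k : ℕ} {b : A} (hb : b ∈ bracketPower S L k) {ds : List A}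
    (hds : ∀ d ∈ ds, d ∈ S) : iterBracket b ds ∈ bracketPower S L (k + ds.length) := by
  induction ds generalizing b k with
  | nil => exact hb
  | cons d ds ih =>
    rw [iterBracket_cons, List.length_cons, show k + (ds.length + 1) = k + 1 + ds.length by ring]
    exact ih (bracketPower_succ_mem hb (hds d (by simp))) fun e he => hds e (by simp [he])

theorem bracketPower_mono {L' : AddSubgroup A} (h : L ≤ L') (k : ℕ) :
    bracketPower S L k ≤ bracketPower S L' k := by
  induction k with
  | zero => exact h
  | succ k ih =>
    refine AddSubgroup.closure_mono ?_
    rintro _ ⟨b, hb, g, hg, rfl⟩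
    exact ⟨b, ih hb, g, hg, rfl⟩

theorem bracketPower_succ_le (hL : ∀ b ∈ L, ∀ g ∈ S, ⁅b, g⁆ ∈ L) (k : ℕ) :
    bracketPower S L (k + 1) ≤ bracketPower S L k := by
  induction k with
  | zero =>
    refine (AddSubgroup.closure_le _).2 ?_
    rintro _ ⟨b, hb, g, hg, rfl⟩
    exact hL b hb g hg
  | succ k ih =>
    refine AddSubgroup.closure_mono ?_
    rintro _ ⟨b, hb, g, hg, rfl⟩
    exact ⟨b, ih hb, g, hg, rfl⟩

theorem bracketPower_antitone (hL : ∀ b ∈ L, ∀ g ∈ S, ⁅b, g⁆ ∈ L) :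
    Antitone (bracketPower S L) :=
  antitone_nat_of_succ_le (bracketPower_succ_le hL)

theorem bracketPower_top_antitone : Antitone (bracketPower S (⊤ : AddSubgroup A)) :=
  bracketPower_antitone fun _ _ _ _ => AddSubgroup.mem_top _

theorem bracketIdeal_antitone : Antitone (bracketIdeal S) := fun _ _ h =>
  Ideal.span_mono (bracketPower_top_antitone h)

theorem mem_bracketIdeal {k : ℕ} {b : A} (hb : b ∈ bracketPower S ⊤ k) : b ∈ bracketIdeal S k :=
  Ideal.subset_span hb

theorem mul_mem_bracketIdeal {k : ℕ} {a g : A} (ha : a ∈ bracketIdeal S k) (hg : g ∈ S) :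
    a * g ∈ bracketIdeal S k := by
  induction ha using Submodule.span_induction with
  | mem b hb =>
    rw [show b * g = g * b + ⁅b, g⁆ by rw [Ring.lie_def]; abel]
    exact add_mem (Ideal.mul_mem_left _ _ (mem_bracketIdeal hb))
      (mem_bracketIdeal (bracketPower_top_antitone (Nat.le_succ k) (bracketPower_succ_mem hb hg)))
  | zero => simp
  | add x y _ _ hx hy => rw [add_mul]; exact add_mem hx hy
  | smul r x _ hx => rw [smul_eq_mul, mul_assoc]; exact Ideal.mul_mem_left _ _ hx

/-- Multiplicativity of the filtration by iterated brackets against brackets of weight `m`. -/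
def BracketProduct (S : Subring A) (m : ℕ) : Prop :=
  ∀ k, ∀ u ∈ bracketPower S ⊤ k, ∀ c ∈ bracketPower S S.toAddSubgroup m,
    u * c ∈ bracketIdeal S (k + m)

theorem bracketProduct_zero : BracketProduct S 0 := fun _ _ hu _ hc =>
  mul_mem_bracketIdeal (mem_bracketIdeal hu) hc

/-- Leibniz expansion: the second factor never reaches weight `m`, so `H` covers every term. -/
theorem iterBracket_mul_mem {m : ℕ} (H : ∀ i < m, BracketProduct S i) {ds : List A}
    (hds : ∀ d ∈ ds, d ∈ S) {i j : ℕ} (h : i + ds.length < m) {u c : A}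
    (hu : u ∈ bracketPower S ⊤ j) (hc : c ∈ bracketPower S S.toAddSubgroup i) :
    iterBracket (u * c) ds ∈ bracketIdeal S (j + i + ds.length) := by
  induction ds generalizing i j u c with
  | nil => exact H i h _ _ hu _ hc
  | cons d ds ih =>
    have hd : d ∈ S := hds d (by simp)
    have hds' : ∀ e ∈ ds, e ∈ S := fun e he => hds e (by simp [he])
    rw [List.length_cons] at h
    rw [iterBracket_cons, mul_bracket, iterBracket_add, List.length_cons]
    refine add_mem ?_ ?_
    · have := ih hds' (i := i + 1) (by omega) hu (bracketPower_succ_mem hc hd)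
      rwa [show j + (i + 1) + ds.length = j + i + (ds.length + 1) by ring] at this
    · have := ih hds' (by omega) (bracketPower_succ_mem hu hd) hc
      rwa [show j + 1 + i + ds.length = j + i + (ds.length + 1) by ring] at this

/-- Here the second factor may reach weight `m`, but only in the Leibniz term where all of `ds` acts
on `c`; that term is subtracted. -/
theorem iterBracket_mul_sub_mem {m : ℕ} (H : ∀ i < m, BracketProduct S i) {ds : List A}
    (hds : ∀ d ∈ ds, d ∈ S) {i j : ℕ} (h : i + ds.length ≤ m) {u c : A}
    (hu : u ∈ bracketPower S ⊤ j) (hc : c ∈ bracketPower S S.toAddSubgroup i) :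
    iterBracket (u * c) ds - u * iterBracket c ds ∈ bracketIdeal S (j + i + ds.length) := by
  induction ds generalizing i j u c with
  | nil => simp
  | cons d ds ih =>
    have hd : d ∈ S := hds d (by simp)
    have hds' : ∀ e ∈ ds, e ∈ S := fun e he => hds e (by simp [he])
    rw [List.length_cons] at h
    rw [iterBracket_cons, mul_bracket, iterBracket_add, List.length_cons, iterBracket_cons,
      add_sub_right_comm]
    refine add_mem ?_ ?_
    · have := ih hds' (i := i + 1) (by omega) hu (bracketPower_succ_mem hc hd)
      rwa [show j + (i + 1) + ds.length = j + i + (ds.length + 1) by ring] at this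
    · have := iterBracket_mul_mem H hds' (i := i) (by omega) (bracketPower_succ_mem hu hd) hc
      rwa [show j + 1 + i + ds.length = j + i + (ds.length + 1) by ring] at this

/-- Antisymmetry in `g`, `c`: apply `ds` to $[b,gc]=[b,g]c+[b,c]g-[[b,c],g]$, whose left side and
last term already have enough weight. -/
theorem bracket_mul_iterBracket_add_mem {m : ℕ} (H : ∀ i < m, BracketProduct S i) {ds : List A}
    (hds : ∀ d ∈ ds, d ∈ S) (h : ds.length = m) {k : ℕ} {b g c : A}
    (hb : b ∈ bracketPower S ⊤ k) (hg : g ∈ S) (hc : c ∈ S) :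
    ⁅b, g⁆ * iterBracket c ds + ⁅b, c⁆ * iterBracket g ds ∈ bracketIdeal S (k + 1 + m) := by
  subst h
  have h1 : iterBracket ⁅b, g * c⁆ ds ∈ bracketIdeal S (k + 1 + ds.length) :=
    mem_bracketIdeal (iterBracket_mem (bracketPower_succ_mem hb (S.mul_mem hg hc)) hds)
  have h2 : iterBracket ⁅⁅b, c⁆, g⁆ ds ∈ bracketIdeal S (k + 1 + ds.length) :=
    bracketIdeal_antitone (by omega)
      (mem_bracketIdeal (iterBracket_mem (bracketPower_succ_mem
        (bracketPower_succ_mem hb hc) hg) hds))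
  have h3 := iterBracket_mul_sub_mem H hds (i := 0) (by omega) (bracketPower_succ_mem hb hg) hc
  have h4 := iterBracket_mul_sub_mem H hds (i := 0) (by omega) (bracketPower_succ_mem hb hc) hg
  rw [Nat.add_zero] at h3 h4
  have e : ⁅b, g * c⁆ = ⁅b, g⁆ * c + (⁅b, c⁆ * g + -⁅⁅b, c⁆, g⁆) := by
    simp only [Ring.lie_def]; noncomm_ring
  rw [e, iterBracket_add, iterBracket_add, iterBracket_neg] at h1
  have := sub_mem (sub_mem (add_mem h1 h2) h3) h4
  convert this using 1
  abel

theorem bracket_mul_iterBracket_bracket_mem {m : ℕ} (H : ∀ i < m, BracketProduct S i)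
    {ds : List A} (hds : ∀ d ∈ ds, d ∈ S) (h : ds.length = m) (hm : m ≠ 0) {k : ℕ} {b g c d : A}
    (hb : b ∈ bracketPower S ⊤ k) (hg : g ∈ S) (hc : c ∈ S) (hd : d ∈ S) :
    ⁅b, g⁆ * iterBracket ⁅c, d⁆ ds ∈ bracketIdeal S (k + 1 + m) := by
  have h1 := bracket_mul_iterBracket_add_mem H hds h hb hg (bracket_mem_subring hc hd)
  suffices h2 : ⁅b, ⁅c, d⁆⁆ * iterBracket g ds ∈ bracketIdeal S (k + 1 + m) by
    simpa using sub_mem h1 h2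
  obtain _ | ⟨e, ds⟩ := ds
  · simp at h; omega
  rw [List.length_cons] at h
  -- By Jacobi the left factor has weight `k + 2`; reading $[g,e]$ as one entry gives the right
  -- factor weight `m - 1`, within reach of `H`.
  have hm' := H (m - 1) (by omega) (k + 2)  ⁅b, ⁅c, d⁆⁆ (by
    rw [bracket_bracket]
    exact sub_mem (bracketPower_succ_mem (bracketPower_succ_mem hb hc) hd)
      (bracketPower_succ_mem (bracketPower_succ_mem hb hd) hc)) (iterBracket g (e :: ds)) (by
    have := iterBracket_mem (k := 0) (L := S.toAddSubgroup) (S := S) (b := ⁅g, e⁆)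
      (bracket_mem_subring hg (hds e (by simp))) (ds := ds) fun e he => hds e (by simp [he])
    rwa [show 0 + ds.length = m - 1 by omega] at this)
  exact bracketIdeal_antitone (by omega) hm'

/-- For fixed `b`, `c`, `ds`, the elements `g ∈ S` with `[b, g] [c, d₁, …, d_m]` of high weight
are closed under multiplication. -/
theorem bracket_mul_iterBracket_mul_mem {m : ℕ} (H : ∀ i < m, BracketProduct S i)
    {ds : List A} (hds : ∀ d ∈ ds, d ∈ S) (h : ds.length = m) (hm : m ≠ 0) {k : ℕ} {b g g' c : A}
    (hb : b ∈ bracketPower S ⊤ k) (hg : g ∈ S) (hg' : g' ∈ S) (hc : c ∈ S)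
    (h1 : ⁅b, g⁆ * iterBracket c ds ∈ bracketIdeal S (k + 1 + m))
    (h2 : ⁅b, g'⁆ * iterBracket c ds ∈ bracketIdeal S (k + 1 + m)) :
    ⁅b, g * g'⁆ * iterBracket c ds ∈ bracketIdeal S (k + 1 + m) := by
  -- Moving `g'` to the right end costs only a product whose second factor is one bracket longer.
  have e : ⁅b, g * g'⁆ * iterBracket c ds = ⁅b, g⁆ * iterBracket c ds * g' +
      g * (⁅b, g'⁆ * iterBracket c ds) - ⁅b, g⁆ * ⁅iterBracket c ds, g'⁆ := by
    simp only [Ring.lie_def]; noncomm_ring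
  rw [e]
  refine sub_mem (add_mem (mul_mem_bracketIdeal h1 hg') (Ideal.mul_mem_left _ _ h2)) ?_
  obtain _ | ⟨d, ds⟩ := ds
  · simp at h; omega
  have := bracket_mul_iterBracket_bracket_mem H (ds := ds ++ [g']) (by
    intro x hx
    rcases List.mem_append.1 hx with hx | hx
    · exact hds x (by simp [hx])
    · rw [List.mem_singleton.1 hx]; exact hg') (by simpa using h) hm hb hg hc (hds d (by simp))
  rwa [iterBracket_append] at this

end BracketFiltration

/-! ### Multiplicativity of the bracket filtration over two generators -/

section TwoGenerators

variable {K A : Type*} [CommRing K] [Ring A] [Algebra K A]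

theorem bracket_algebraMap (b : A) (r : K) : ⁅b, algebraMap K A r⁆ = 0 := by
  rw [Ring.lie_def, Algebra.commutes, sub_self]

theorem bracketProduct_step {x y : A} (h2 : IsUnit (2 : A)) {m : ℕ} (hm : m ≠ 0)
    (H : ∀ i < m, BracketProduct (Algebra.adjoin K {x, y}).toSubring i) {k : ℕ} {b g c : A}
    {ds : List A} (hb : b ∈ bracketPower (Algebra.adjoin K {x, y}).toSubring ⊤ k)
    (hg : g ∈ Algebra.adjoin K {x, y}) (hc : c ∈ Algebra.adjoin K {x, y})
    (hds : ∀ d ∈ ds, d ∈ Algebra.adjoin K {x, y}) (h : ds.length = m) :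
    ⁅b, g⁆ * iterBracket c ds ∈ bracketIdeal (Algebra.adjoin K {x, y}).toSubring (k + 1 + m) := by
  obtain _ | ⟨d, ds⟩ := ds
  · simp at h; omega
  have hd : d ∈ Algebra.adjoin K {x, y} := hds d (by simp)
  have hds' : ∀ e ∈ ds, e ∈ Algebra.adjoin K {x, y} := fun e he => hds e (by simp [he])
  clear hds
  set S := (Algebra.adjoin K {x, y}).toSubring with hS
  have memS : ∀ {a}, a ∈ Algebra.adjoin K {x, y} → a ∈ S := fun h => h
  let P : A → A → A → Prop := fun g c d =>
    ⁅b, g⁆ * iterBracket c (d :: ds) ∈ bracketIdeal S (k + 1 + m)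
  have hcons : ∀ {d}, d ∈ Algebra.adjoin K {x, y} → ∀ e ∈ d :: ds, e ∈ S := by
    intro d hd e he
    rcases List.mem_cons.1 he with rfl | he
    exacts [hd, hds' e he]
  have swap : ∀ {g c d}, g ∈ Algebra.adjoin K {x, y} → c ∈ Algebra.adjoin K {x, y} →
      d ∈ Algebra.adjoin K {x, y} → P g c d → P c g d := by
    intro g c d hg hc hd hP
    have := bracket_mul_iterBracket_add_mem H (hcons hd) h hb hg hc
    have h3 := sub_mem this hP
    rwa [add_sub_cancel_left] at h3
  have swap' : ∀ {g c d}, P g c d → P g d c := by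
    intro g c d hP
    have e : ⁅d, c⁆ = -⁅c, d⁆ := by simp only [Ring.lie_def]; abel
    simp only [P, iterBracket_cons] at hP ⊢
    rw [e, iterBracket_neg, mul_neg]
    exact neg_mem hP
  -- Antisymmetry gives only twice the claim; invertibility of 2 makes `P` alternating.
  have diag : ∀ {c d}, c ∈ Algebra.adjoin K {x, y} → d ∈ Algebra.adjoin K {x, y} → P c c d := by
    intro c d hc hd
    have := bracket_mul_iterBracket_add_mem H (hcons hd) h hb hc hc
    rw [← two_mul] at this
    obtain ⟨u, hu⟩ := h2
    have h3 := Ideal.mul_mem_left _ (↑u⁻¹ : A) this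
    rwa [← mul_assoc, ← hu, Units.inv_mul, one_mul] at h3
  have ind : ∀ {c d}, c ∈ Algebra.adjoin K {x, y} → d ∈ Algebra.adjoin K {x, y} →
      P x c d → P y c d → ∀ {g}, g ∈ Algebra.adjoin K {x, y} → P g c d := by
    intro c d hc hd hx hy g hg
    induction hg using Algebra.adjoin_induction with
    | mem a ha => rcases ha with rfl | rfl <;> assumption
    | algebraMap r => simp only [P, bracket_algebraMap, zero_mul, zero_mem]
    | add a a' _ _ h1 h2 =>
      simp only [P, bracket_add_right, add_mul] at h1 h2 ⊢
      exact add_mem h1 h2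
    | mul a a' ha ha' h1 h2 =>
      exact bracket_mul_iterBracket_mul_mem H (hcons hd) h hm hb (memS ha) (memS ha') (memS hc)
        h1 h2
  have hx : x ∈ Algebra.adjoin K {x, y} := Algebra.subset_adjoin (by simp)
  have hy : y ∈ Algebra.adjoin K {x, y} := Algebra.subset_adjoin (by simp)
  have diag' : ∀ {c d}, c ∈ Algebra.adjoin K {x, y} → d ∈ Algebra.adjoin K {x, y} → P c d c :=
    fun hc hd => swap' (diag hc hd)
  have diag'' : ∀ {c d}, c ∈ Algebra.adjoin K {x, y} → d ∈ Algebra.adjoin K {x, y} → P d c c :=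
    fun hc hd => swap hc hd hc (diag' hc hd)
  -- Three entries from two generators must repeat, which settles the base case; the entries are
  -- then freed one at a time.
  have s1 : ∀ {c d}, c ∈ ({x, y} : Set A) → d ∈ ({x, y} : Set A) →
      ∀ {g}, g ∈ Algebra.adjoin K {x, y} → P g c d := by
    rintro c d (rfl | rfl) (rfl | rfl) g hg
    · exact ind hx hx (diag hx hx) (diag'' hx hy) hg
    · exact ind hx hy (diag hx hy) (diag' hy hx) hg
    · exact ind hy hx (diag' hx hy) (diag hy hx) hg
    · exact ind hy hy (diag'' hy hx) (diag hy hy) hg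
  have s2 : ∀ {d}, d ∈ ({x, y} : Set A) → ∀ {g c}, g ∈ Algebra.adjoin K {x, y} →
      c ∈ Algebra.adjoin K {x, y} → P g c d := by
    intro d hd g c hg hc
    have hd' := Algebra.subset_adjoin (R := K) hd
    exact swap hc hg hd' (ind hg hd' (swap hg hx hd' (s1 (by simp) hd hg))
      (swap hg hy hd' (s1 (by simp) hd hg)) hc)
  exact swap' (swap hd hg hc (ind hg hc (swap hg hx hc (swap' (s2 (by simp) hg hc)))
    (swap hg hy hc (swap' (s2 (by simp) hg hc))) hd))

/-- Induction principle: additive properties need checking only on iterated brackets. -/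
theorem exists_iterBracket_of_mem {S : Subring A} {L : AddSubgroup A} {m : ℕ} {p : A → Prop}
    (h0 : p 0) (hadd : ∀ a b, p a → p b → p (a + b)) (hneg : ∀ a, p a → p (-a))
    (h : ∀ c ∈ L, ∀ ds : List A, (∀ d ∈ ds, d ∈ S) → ds.length = m → p (iterBracket c ds))
    {a : A} (ha : a ∈ bracketPower S L m) : p a := by
  induction m generalizing p a with
  | zero => exact h a ha [] (by simp) rfl
  | succ m ih =>
    induction ha using AddSubgroup.closure_induction with
    | mem a ha =>
      obtain ⟨b, hb, g, hg, rfl⟩ := ha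
      refine ih (p := fun b => p ⁅b, g⁆) (by simpa [Ring.lie_def] using h0) ?_ ?_ ?_ hb
      · intro a b ha hb; rw [bracket_add_left]; exact hadd _ _ ha hb
      · intro a ha; rw [bracket_neg_left]; exact hneg _ ha
      · intro c hc ds hds hl
        have := h c hc (ds ++ [g]) (by
          intro e he
          rcases List.mem_append.1 he with he | he
          · exact hds e he
          · rw [List.mem_singleton.1 he]; exact hg) (by simp [hl])
        rwa [iterBracket_append] at this
    | zero => exact h0
    | add a b _ _ ha hb => exact hadd _ _ ha hb
    | neg a _ ha => exact hneg _ ha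

/-- In rank two the iterated-bracket filtration is multiplicative. -/
theorem bracketProduct_adjoin_pair (x y : A) (h2 : IsUnit (2 : A)) (m : ℕ) :
    BracketProduct (Algebra.adjoin K {x, y}).toSubring m := by
  induction m using Nat.strong_induction_on with
  | _ m H =>
    obtain rfl | hm := eq_or_ne m 0
    · exact bracketProduct_zero
    intro k u hu c hc
    obtain _ | k := k
    -- With no bracket on the left, `u` is just a left multiplier.
    · rw [Nat.zero_add]
      exact Ideal.mul_mem_left _ _ (mem_bracketIdeal (bracketPower_mono le_top _ hc))
    refine exists_iterBracket_of_mem (p := fun c => u * c ∈ _) (by simp)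
      (fun a b ha hb => by rw [mul_add]; exact add_mem ha hb)
      (fun a ha => by rw [mul_neg]; exact neg_mem ha) ?_ hc
    intro c hc ds hds hl
    induction hu using AddSubgroup.closure_induction with
    | mem a ha =>
      obtain ⟨b, hb, g, hg, rfl⟩ := ha
      exact bracketProduct_step h2 hm H hb hg hc hds hl
    | zero => simp
    | add a b _ _ ha hb => rw [add_mul]; exact add_mem ha hb
    | neg a _ ha => rw [neg_mul]; exact neg_mem ha

end TwoGenerators

/-! ### Weight filtration by products of commutators of generators -/

section WeightFiltration

variable {K A X : Type*} [CommRing K] [Ring A] [Algebra K A]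

/-- `IsLieMonomial s m a`: `a` is a left-normed commutator of `m + 1` of the elements `s i`. -/
inductive IsLieMonomial (s : X → A) : ℕ → A → Prop
  | gen (i : X) : IsLieMonomial s 0 (s i)
  | bracket {m : ℕ} {a : A} (i : X) (h : IsLieMonomial s m a) : IsLieMonomial s (m + 1) ⁅a, s i⁆

/-- `IsProdMonomial s k a`: `a` is a product of left-normed commutators of total weight `k`, where
a commutator of length `m + 1` has weight `m`. -/
inductive IsProdMonomial (s : X → A) : ℕ → A → Prop
  | one : IsProdMonomial s 0 1
  | mul {m k : ℕ} {a b : A} (ha : IsLieMonomial s m a) (hb : IsProdMonomial s k b) :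
      IsProdMonomial s (m + k) (a * b)

/-- The span of the products of left-normed commutators of total weight at least `k`. -/
def weightSpan (K : Type*) [CommRing K] [Algebra K A] (s : X → A) (k : ℕ) : Submodule K A :=
  Submodule.span K {b | ∃ j, k ≤ j ∧ IsProdMonomial s j b}

variable {s : X → A}

theorem IsProdMonomial.mul_prod {j k : ℕ} {a b : A} (ha : IsProdMonomial s j a)
    (hb : IsProdMonomial s k b) : IsProdMonomial s (j + k) (a * b) := by
  induction ha with
  | one => simpa using hb
  | mul h _ ih => rw [mul_assoc, add_assoc]; exact .mul h ih

theorem IsLieMonomial.isProdMonomial {m : ℕ} {a : A} (ha : IsLieMonomial s m a) :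
    IsProdMonomial s m a := by
  simpa using IsProdMonomial.mul ha .one

theorem IsProdMonomial.mem {j k : ℕ} {a : A} (ha : IsProdMonomial s j a) (h : k ≤ j) :
    a ∈ weightSpan K s k :=
  Submodule.subset_span ⟨j, h, ha⟩

theorem weightSpan_antitone : Antitone (weightSpan K s) := fun _ _ h =>
  Submodule.span_mono fun _ ⟨j, hj, hb⟩ => ⟨j, h.trans hj, hb⟩

theorem mul_mem_weightSpan {j k : ℕ} {a b : A} (ha : a ∈ weightSpan K s j)
    (hb : b ∈ weightSpan K s k) : a * b ∈ weightSpan K s (j + k) := by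
  induction ha using Submodule.span_induction with
  | mem a ha =>
    obtain ⟨i, hi, ha⟩ := ha
    induction hb using Submodule.span_induction with
    | mem b hb =>
      obtain ⟨l, hl, hb⟩ := hb
      exact (ha.mul_prod hb).mem (by omega)
    | zero => simp
    | add x y _ _ hx hy => rw [mul_add]; exact add_mem hx hy
    | smul r x _ hx => rw [mul_smul_comm]; exact Submodule.smul_mem _ _ hx
  | zero => simp
  | add x y _ _ hx hy => rw [add_mul]; exact add_mem hx hy
  | smul r x _ hx => rw [smul_mul_assoc]; exact Submodule.smul_mem _ _ hx

theorem IsProdMonomial.bracket_mem {j : ℕ} {a : A} (ha : IsProdMonomial s j a) (i : X) :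
    ⁅a, s i⁆ ∈ weightSpan K s (j + 1) := by
  induction ha with
  | one => simp [Ring.lie_def]
  | @mul m k a b ha hb ih =>
    rw [mul_bracket]
    refine add_mem ?_ ?_
    · rw [add_assoc]
      exact mul_mem_weightSpan (ha.isProdMonomial.mem le_rfl) ih
    · have := mul_mem_weightSpan (K := K) ((ha.bracket i).isProdMonomial.mem le_rfl)
        (hb.mem le_rfl)
      rwa [show m + 1 + k = m + k + 1 by ring] at this

theorem bracket_gen_mem_weightSpan {j : ℕ} {a : A} (ha : a ∈ weightSpan K s j) (i : X) :
    ⁅a, s i⁆ ∈ weightSpan K s (j + 1) := by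
  induction ha using Submodule.span_induction with
  | mem a ha =>
    obtain ⟨l, hl, ha⟩ := ha
    exact weightSpan_antitone (by omega) (ha.bracket_mem i)
  | zero => simp [Ring.lie_def]
  | add x y _ _ hx hy => rw [bracket_add_left]; exact add_mem hx hy
  | smul r x _ hx =>
    rw [Ring.lie_def, smul_mul_assoc, mul_smul_comm, ← smul_sub, ← Ring.lie_def]
    exact Submodule.smul_mem _ _ hx

/-- By Jacobi, bracketing with a commutator is a combination of `m + 1` successive brackets with
generators, each gaining one. -/
theorem bracket_lieMonomial_mem_weightSpan {j m : ℕ} {a b : A} (ha : a ∈ weightSpan K s j)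
    (hb : IsLieMonomial s m b) : ⁅a, b⁆ ∈ weightSpan K s (j + m + 1) := by
  induction hb generalizing j a with
  | gen i => exact bracket_gen_mem_weightSpan ha i
  | @bracket m b i _ ih =>
    rw [bracket_bracket]
    refine sub_mem (bracket_gen_mem_weightSpan (ih ha) i) ?_
    have := ih (bracket_gen_mem_weightSpan ha i)
    rwa [show j + 1 + m + 1 = j + (m + 1) + 1 by ring] at this

end WeightFiltration

/-! ### The weight filtration of a free algebra -/

section FreeWeight

variable {K X : Type*} [CommRing K]

theorem mem_weightSpan_zero (a : FreeAlgebra K X) :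
    a ∈ weightSpan K (FreeAlgebra.ι K : X → FreeAlgebra K X) 0 := by
  induction a using FreeAlgebra.induction with
  | grade0 r =>
    rw [Algebra.algebraMap_eq_smul_one]
    exact Submodule.smul_mem _ _ (IsProdMonomial.one.mem le_rfl)
  | grade1 i => exact (IsLieMonomial.gen i).isProdMonomial.mem le_rfl
  | mul a b ha hb =>
    have := mul_mem_weightSpan ha hb
    rwa [Nat.add_zero] at this
  | add a b ha hb => exact add_mem ha hb

theorem bracket_mem_weightSpan {j : ℕ} {a : FreeAlgebra K X}
    (ha : a ∈ weightSpan K (FreeAlgebra.ι K : X → FreeAlgebra K X) j) (b : FreeAlgebra K X) :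
    ⁅a, b⁆ ∈ weightSpan K (FreeAlgebra.ι K : X → FreeAlgebra K X) (j + 1) := by
  induction b using FreeAlgebra.induction with
  | grade0 r => rw [bracket_algebraMap]; exact zero_mem _
  | grade1 i => exact bracket_gen_mem_weightSpan ha i
  | mul b c hb hc =>
    rw [bracket_mul]
    have h1 := mul_mem_weightSpan hb (mem_weightSpan_zero c)
    have h2 := mul_mem_weightSpan (mem_weightSpan_zero b) hc
    rw [zero_add] at h2
    exact add_mem h1 h2
  | add b c hb hc => rw [bracket_add_right]; exact add_mem hb hc

theorem leftNormedCommutator_succ {A : Type*} [Ring A] (v : ℕ → A) (k : ℕ) :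
    leftNormedCommutator v (k + 2) = ⁅leftNormedCommutator v (k + 1), v (k + 1)⁆ := rfl

theorem map_leftNormedCommutator {A B : Type*} [Ring A] [Ring B] (φ : A →+* B) (v : ℕ → A) :
    ∀ k, φ (leftNormedCommutator v k) = leftNormedCommutator (fun i => φ (v i)) k
  | 0 => map_zero φ
  | 1 => rfl
  | k + 2 => by
    simp only [leftNormedCommutator, map_sub, map_mul, map_leftNormedCommutator φ v (k + 1)]

theorem leftNormedCommutator_mem_weightSpan (v : ℕ → FreeAlgebra K X) (k : ℕ) :
    leftNormedCommutator v (k + 1) ∈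
      weightSpan K (FreeAlgebra.ι K : X → FreeAlgebra K X) k := by
  induction k with
  | zero => exact mem_weightSpan_zero _
  | succ k ih => exact bracket_mem_weightSpan ih _

/-- The weight filtration of a free algebra by two-sided ideals. -/
def weightIdeal (K X : Type*) [CommRing K] (k : ℕ) : TwoSidedIdeal (FreeAlgebra K X) :=
  TwoSidedIdeal.mk' (weightSpan K (FreeAlgebra.ι K : X → FreeAlgebra K X) k : Set _)
    (zero_mem _) add_mem neg_mem
    (fun {x y} hy => by
      have := mul_mem_weightSpan (mem_weightSpan_zero x) hy
      rwa [zero_add] at this)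
    (fun {x y} hx => by
      have := mul_mem_weightSpan hx (mem_weightSpan_zero y)
      rwa [Nat.add_zero] at this)

theorem mem_weightIdeal {k : ℕ} {a : FreeAlgebra K X} :
    a ∈ weightIdeal K X k ↔ a ∈ weightSpan K (FreeAlgebra.ι K : X → FreeAlgebra K X) k :=
  TwoSidedIdeal.mem_mk' _ _ _ _ _ _ _

end FreeWeight

/-! ### T-ideals and their images -/

section TIdeal

variable {K : Type*} [CommRing K]

theorem mem_tIdealSpan_iff {A : Type*} [Ring A] [Algebra K A] {S : Set A} {a : A} :
    a ∈ tIdealSpan K S ↔ ∀ I : TwoSidedIdeal A, S ⊆ (I : Set A) → IsTIdeal K I → a ∈ I := by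
  rw [tIdealSpan, TwoSidedIdeal.mem_sInf]
  exact ⟨fun h I h1 h2 => h I ⟨h1, h2⟩, fun h I hI => h I hI.1 hI.2⟩

theorem leftNormedCommutator_mem_lieNilpotentTIdeal (n : ℕ) (v : ℕ → FreeAlgebra K ℕ) :
    leftNormedCommutator v n ∈ lieNilpotentTIdeal K n := by
  refine mem_tIdealSpan_iff.2 fun I h1 h2 => ?_
  have := h2 (FreeAlgebra.lift K v) _ (h1 rfl)
  have e := map_leftNormedCommutator (FreeAlgebra.lift K v).toRingHom (FreeAlgebra.ι K) n
  simp only [AlgHom.toRingHom_eq_coe, RingHom.coe_coe, FreeAlgebra.lift_ι_apply] at e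
  rwa [e] at this

/-- A two-sided ideal of `A` that contains all commutators of length `n` contains the image of
`T^(n)` under every homomorphism. -/
theorem map_mem_of_mem_lieNilpotentTIdeal {A : Type*} [Ring A] [Algebra K A] {n : ℕ}
    (J : TwoSidedIdeal A) (hJ : ∀ v : ℕ → A, leftNormedCommutator v n ∈ J)
    (φ : FreeAlgebra K ℕ →ₐ[K] A) {a : FreeAlgebra K ℕ} (ha : a ∈ lieNilpotentTIdeal K n) :
    φ a ∈ J := by
  have := mem_tIdealSpan_iff.1 ha
    -- Intersecting over all homomorphisms makes the preimage of `J` stable under endomorphisms.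
    (⨅ ψ : FreeAlgebra K ℕ →ₐ[K] A, TwoSidedIdeal.comap ψ J) ?_ ?_
  · exact (TwoSidedIdeal.mem_comap _).1 ((TwoSidedIdeal.mem_iInf _).1 this φ)
  · rintro _ rfl
    refine (TwoSidedIdeal.mem_iInf _).2 fun ψ => (TwoSidedIdeal.mem_comap _).2 ?_
    have e := map_leftNormedCommutator ψ.toRingHom (FreeAlgebra.ι K) n
    simp only [AlgHom.toRingHom_eq_coe, RingHom.coe_coe] at e
    rw [e]
    exact hJ _
  · intro χ f hf
    refine (TwoSidedIdeal.mem_iInf _).2 fun ψ => (TwoSidedIdeal.mem_comap _).2 ?_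
    exact (TwoSidedIdeal.mem_comap (ψ.comp χ)).1 ((TwoSidedIdeal.mem_iInf _).1 hf (ψ.comp χ))

theorem map_mem_weightSpan {X : Type*} {k : ℕ} (φ : FreeAlgebra K ℕ →ₐ[K] FreeAlgebra K X)
    {a : FreeAlgebra K ℕ} (ha : a ∈ lieNilpotentTIdeal K (k + 1)) :
    φ a ∈ weightSpan K (FreeAlgebra.ι K : X → FreeAlgebra K X) k :=
  mem_weightIdeal.1 (map_mem_of_mem_lieNilpotentTIdeal (weightIdeal K X k)
    (fun v => mem_weightIdeal.2 (leftNormedCommutator_mem_weightSpan v k)) φ ha)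

end TIdeal

/-! ### Coproduct of the free algebra and its coefficients at words -/

section Coproduct

open MonoidAlgebra

variable {K X : Type*} [CommRing K]

/-- The coproduct of the free algebra, with values in the algebra of noncommutative polynomials
with (commuting) coefficients in the free algebra; it makes the generators primitive. -/
noncomputable def wordCoproduct (K X : Type*) [CommRing K] :
    FreeAlgebra K X →ₐ[K] MonoidAlgebra (FreeAlgebra K X) (FreeMonoid X) :=
  FreeAlgebra.lift K fun i => single (FreeMonoid.of i) 1 + single 1 (FreeAlgebra.ι K i)

/-- The embedding of the free algebra by words with scalar coefficients. -/
noncomputable def wordEmbedding (K X : Type*) [CommRing K] :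
    FreeAlgebra K X →ₐ[K] MonoidAlgebra (FreeAlgebra K X) (FreeMonoid X) :=
  FreeAlgebra.lift K fun i => single (FreeMonoid.of i) 1

@[simp] theorem wordCoproduct_ι (i : X) : wordCoproduct K X (FreeAlgebra.ι K i) =
    single (FreeMonoid.of i) 1 + single 1 (FreeAlgebra.ι K i) :=
  FreeAlgebra.lift_ι_apply _ _

@[simp] theorem wordEmbedding_ι (i : X) :
    wordEmbedding K X (FreeAlgebra.ι K i) = single (FreeMonoid.of i) 1 :=
  FreeAlgebra.lift_ι_apply _ _

theorem wordEmbedding_commute (a b : FreeAlgebra K X) :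
    Commute (wordEmbedding K X a) (single 1 b) := by
  induction a using FreeAlgebra.induction with
  | grade0 r => rw [AlgHom.commutes]; exact Algebra.commutes _ _
  | grade1 i => simp [Commute, SemiconjBy]
  | mul a a' h h' => rw [map_mul]; exact h.mul_left h'
  | add a a' h h' => rw [map_add]; exact h.add_left h'

/-- Brackets of primitive elements are primitive, because the two tensor factors commute. -/
theorem IsLieMonomial.wordCoproduct_eq {m : ℕ} {a : FreeAlgebra K X}
    (ha : IsLieMonomial (FreeAlgebra.ι K) m a) :
    wordCoproduct K X a = wordEmbedding K X a + single 1 a := by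
  induction ha with
  | gen i => simp
  | @bracket m a i _ ih =>
    have h1 := (wordEmbedding_commute a (FreeAlgebra.ι K i)).eq
    have h2 := (wordEmbedding_commute (FreeAlgebra.ι K i) a).eq
    rw [wordEmbedding_ι] at h2
    have e : single (1 : FreeMonoid X) (⁅a, FreeAlgebra.ι K i⁆) =
        single 1 a * single 1 (FreeAlgebra.ι K i) -
          single 1 (FreeAlgebra.ι K i) * single 1 a := by
      rw [single_mul_single, single_mul_single, one_mul, Ring.lie_def, single_sub]
    rw [e, Ring.lie_def]
    simp only [map_sub, map_mul, ih, wordCoproduct_ι, wordEmbedding_ι, mul_add, add_mul, h1, h2]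
    abel

theorem IsLieMonomial.wordEmbedding_mem {m : ℕ} {a : FreeAlgebra K X}
    (ha : IsLieMonomial (FreeAlgebra.ι K) m a) : wordEmbedding K X a ∈
      Submodule.span K {p | ∃ v : FreeMonoid X, v.length = m + 1 ∧ p = single v 1} := by
  induction ha with
  | gen i =>
    rw [wordEmbedding_ι]
    exact Submodule.subset_span ⟨_, FreeMonoid.length_of i, rfl⟩
  | @bracket m a i _ ih =>
    rw [Ring.lie_def, map_sub, map_mul, map_mul, wordEmbedding_ι]
    generalize wordEmbedding K X a = q at ih
    induction ih using Submodule.span_induction with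
    | mem p hp =>
      obtain ⟨v, hv, rfl⟩ := hp
      rw [single_mul_single, single_mul_single, one_mul]
      refine sub_mem (Submodule.subset_span ⟨_, ?_, rfl⟩)
        (Submodule.subset_span ⟨_, ?_, rfl⟩) <;>
        rw [FreeMonoid.length_mul, FreeMonoid.length_of] <;> omega
    | zero => simp
    | add p q _ _ hp hq =>
      rw [add_mul, mul_add, add_sub_add_comm]
      exact add_mem hp hq
    | smul r p _ hp =>
      rw [smul_mul_assoc, mul_smul_comm, ← smul_sub]
      exact Submodule.smul_mem _ _ hp

theorem coeff_single_mul_mem {p : MonoidAlgebra (FreeAlgebra K X) (FreeMonoid X)}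
    (W : Submodule K (FreeAlgebra K X)) {v u : FreeMonoid X}
    (h : ∀ v', v * v' = u → p.coeff v' ∈ W) :
    (single v (1 : FreeAlgebra K X) * p).coeff u ∈ W := by
  by_cases hu : ∃ v', v * v' = u
  · obtain ⟨v', rfl⟩ := hu
    rw [coeff_single_mul_eq_mul_coeff v' (fun w _ => mul_right_inj v), one_mul]
    exact h v' rfl
  · rw [coeff_single_mul_of_forall_mul_ne]
    · exact zero_mem _
    · exact fun d hd => hu ⟨d, hd⟩

/-- Each commutator goes wholly to one tensor factor. One of weight $m$ absorbed into `u`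
contributes `m + 1` letters, so the loss is at most `u.length - 1` for nonempty `u`; truncated
subtraction gives no loss at the empty word. -/
theorem IsProdMonomial.coeff_wordCoproduct_mem {j : ℕ} {b : FreeAlgebra K X}
    (hb : IsProdMonomial (FreeAlgebra.ι K) j b) (u : FreeMonoid X) :
    (wordCoproduct K X b).coeff u ∈ weightSpan K (FreeAlgebra.ι K) (j - (u.length - 1)) := by
  induction hb generalizing u with
  | one => rw [Nat.zero_sub]; exact mem_weightSpan_zero _
  | @mul m k a b ha hb ih =>
    rw [map_mul, ha.wordCoproduct_eq, add_mul, coeff_add, Finsupp.add_apply]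
    refine add_mem ?_ ?_
    · have h := ha.wordEmbedding_mem
      generalize wordEmbedding K X a = p at h
      induction h using Submodule.span_induction with
      | mem p hp =>
        obtain ⟨v, hv, rfl⟩ := hp
        refine coeff_single_mul_mem _ fun v' hv' => weightSpan_antitone ?_ (ih v')
        rw [← hv', FreeMonoid.length_mul]
        omega
      | zero => simp
      | add p q _ _ hp hq =>
        rw [add_mul, coeff_add, Finsupp.add_apply]
        exact add_mem hp hq
      | smul r p _ hp =>
        rw [smul_mul_assoc, coeff_smul, Finsupp.smul_apply]
        exact Submodule.smul_mem _ _ hp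
    · rw [coeff_single_one_mul]
      exact weightSpan_antitone (by omega)
        (mul_mem_weightSpan (ha.isProdMonomial.mem le_rfl) (ih u))

theorem coeff_wordCoproduct_mem {k : ℕ} {b : FreeAlgebra K X}
    (hb : b ∈ weightSpan K (FreeAlgebra.ι K) k) (u : FreeMonoid X) :
    (wordCoproduct K X b).coeff u ∈ weightSpan K (FreeAlgebra.ι K) (k - (u.length - 1)) := by
  induction hb using Submodule.span_induction with
  | mem b hb =>
    obtain ⟨j, hj, hb⟩ := hb
    exact weightSpan_antitone (by omega) (hb.coeff_wordCoproduct_mem u)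
  | zero => simp
  | add p q _ _ hp hq => rw [map_add, coeff_add, Finsupp.add_apply]; exact add_mem hp hq
  | smul r p _ hp =>
    rw [map_smul, coeff_smul, Finsupp.smul_apply]
    exact Submodule.smul_mem _ _ hp

theorem coeff_wordCoproduct_one (a : FreeAlgebra K X) : (wordCoproduct K X a).coeff 1 = a := by
  -- The factor `p` makes the statement compose under products.
  suffices h : ∀ p : MonoidAlgebra (FreeAlgebra K X) (FreeMonoid X),
      (wordCoproduct K X a * p).coeff 1 = a * p.coeff 1 by
    have := h 1
    rwa [mul_one, one_def, coeff_single, Finsupp.single_eq_same, mul_one] at this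
  induction a using FreeAlgebra.induction with
  | grade0 r =>
    intro p
    rw [AlgHom.commutes, ← Algebra.smul_def, coeff_smul, Finsupp.smul_apply, Algebra.smul_def]
  | grade1 i =>
    intro p
    rw [wordCoproduct_ι, add_mul, coeff_add, Finsupp.add_apply, coeff_single_one_mul,
      coeff_single_mul_of_forall_mul_ne, zero_add]
    intro d hd
    have := congrArg FreeMonoid.length hd
    simp at this
  | mul a b ha hb => intro p; rw [map_mul, mul_assoc, ha, hb, mul_assoc]
  | add a b ha hb =>
    intro p
    rw [map_add, add_mul, coeff_add, Finsupp.add_apply, ha, hb, add_mul]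

/-! ### Isolating a coefficient with Engel commutators -/

/-- The commutator `[t, s, …, s]` with `N` entries `s`. -/
noncomputable def engelCommutator (K : Type*) {X : Type*} [CommRing K] (s t : X) :
    ℕ → FreeAlgebra K X
  | 0 => FreeAlgebra.ι K t
  | N + 1 => ⁅engelCommutator K s t N, FreeAlgebra.ι K s⁆

theorem isLieMonomial_engelCommutator (s t : X) (N : ℕ) :
    IsLieMonomial (FreeAlgebra.ι K) N (engelCommutator K s t N) := by
  induction N with
  | zero => exact .gen t
  | succ N ih => exact .bracket s ih

theorem bracket_engelCommutator_mem {s t : X} {k : ℕ} {f : FreeAlgebra K X}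
    (hs : ⁅f, FreeAlgebra.ι K s⁆ ∈ weightSpan K (FreeAlgebra.ι K : X → FreeAlgebra K X) k)
    (ht : ⁅f, FreeAlgebra.ι K t⁆ ∈ weightSpan K (FreeAlgebra.ι K : X → FreeAlgebra K X) k)
    (N : ℕ) : ⁅f, engelCommutator K s t N⁆ ∈
      weightSpan K (FreeAlgebra.ι K : X → FreeAlgebra K X) (k + N) := by
  induction N with
  | zero => exact ht
  | succ N ih =>
    rw [engelCommutator, bracket_bracket]
    exact sub_mem (bracket_gen_mem_weightSpan ih s)
      (bracket_lieMonomial_mem_weightSpan hs (isLieMonomial_engelCommutator s t N))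

theorem coeff_mul_single_cancel (p : MonoidAlgebra (FreeAlgebra K X) (FreeMonoid X))
    (u v : FreeMonoid X) : (p * single v 1).coeff (u * v) = p.coeff u := by
  rw [coeff_mul_single_eq_coeff_mul u fun w _ => mul_left_inj v, mul_one]

/-- Words of the commutator contain one `t` and only `N` letters `s`, so none can end in $s^{N+1}$.
-/
theorem coeff_mul_engel_eq_zero {s t : X} (hst : s ≠ t) (N : ℕ)
    (p : MonoidAlgebra (FreeAlgebra K X) (FreeMonoid X)) (u : FreeMonoid X) :
    (p * wordEmbedding K X (engelCommutator K s t N)).coeff (u * FreeMonoid.of s ^ (N + 1)) =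
      0 := by
  induction N generalizing p u with
  | zero =>
    rw [engelCommutator, wordEmbedding_ι, zero_add, pow_one]
    refine coeff_mul_single_of_forall_mul_ne _ _ fun d hd => hst ?_
    have := congrArg (fun w => (FreeMonoid.toList w).getLast?) hd
    simpa [FreeMonoid.toList_mul, FreeMonoid.toList_of, eq_comm] using this
  | succ N ih =>
    rw [engelCommutator, Ring.lie_def, map_sub (wordEmbedding K X), map_mul (wordEmbedding K X),
      map_mul (wordEmbedding K X), mul_sub, coeff_sub,
      Finsupp.sub_apply, ← mul_assoc, ← mul_assoc, wordEmbedding_ι]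
    nth_rw 1 [pow_succ (FreeMonoid.of s)]
    rw [← mul_assoc u, coeff_mul_single_cancel, ih, pow_succ' (FreeMonoid.of s), ← mul_assoc u,
      ih, sub_zero]

/-- The only word of the commutator ending in $t\,s^N$ is $t\,s^N$ itself, with coefficient 1. -/
theorem coeff_mul_engel {s t : X} (hst : s ≠ t) (N : ℕ)
    (p : MonoidAlgebra (FreeAlgebra K X) (FreeMonoid X)) (u : FreeMonoid X) :
    (p * wordEmbedding K X (engelCommutator K s t N)).coeff
      (u * FreeMonoid.of t * FreeMonoid.of s ^ N) = p.coeff u := by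
  induction N generalizing p with
  | zero => rw [engelCommutator, wordEmbedding_ι, pow_zero, mul_one, coeff_mul_single_cancel]
  | succ N ih =>
    rw [engelCommutator, Ring.lie_def, map_sub (wordEmbedding K X), map_mul (wordEmbedding K X),
      map_mul (wordEmbedding K X), mul_sub, coeff_sub,
      Finsupp.sub_apply, ← mul_assoc, ← mul_assoc, wordEmbedding_ι]
    rw [coeff_mul_engel_eq_zero hst, sub_zero, pow_succ, ← mul_assoc, coeff_mul_single_cancel, ih]

theorem wordEmbedding_engel_mem (s t : X) (N : ℕ) :
    wordEmbedding K X (engelCommutator K s t N) ∈ Submodule.span K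
      {p | ∃ i j : ℕ, p = single (FreeMonoid.of s ^ i * FreeMonoid.of t * FreeMonoid.of s ^ j)
        (1 : FreeAlgebra K X)} := by
  induction N with
  | zero =>
    rw [engelCommutator, wordEmbedding_ι]
    exact Submodule.subset_span ⟨0, 0, by simp⟩
  | succ N ih =>
    rw [engelCommutator, Ring.lie_def, map_sub, map_mul, map_mul, wordEmbedding_ι]
    generalize wordEmbedding K X (engelCommutator K s t N) = q at ih
    induction ih using Submodule.span_induction with
    | mem p hp =>
      obtain ⟨i, j, rfl⟩ := hp
      rw [single_mul_single, single_mul_single, one_mul]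
      refine sub_mem (Submodule.subset_span ⟨i, j + 1, ?_⟩)
        (Submodule.subset_span ⟨i + 1, j, ?_⟩)
      · simp only [pow_succ, mul_assoc]
      · simp only [pow_succ', mul_assoc]
    | zero => simp
    | add p q _ _ hp hq =>
      rw [add_mul, mul_add, add_sub_add_comm]
      exact add_mem hp hq
    | smul r p _ hp =>
      rw [smul_mul_assoc, mul_smul_comm, ← smul_sub]
      exact Submodule.smul_mem _ _ hp

theorem toList_of_pow (s : X) (n : ℕ) :
    FreeMonoid.toList (FreeMonoid.of s ^ n) = List.replicate n s := by
  induction n with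
  | zero => rfl
  | succ n ih =>
    rw [pow_succ, FreeMonoid.toList_mul, ih, FreeMonoid.toList_of, List.replicate_succ']

/-- A word of `p` that is a suffix of the target has length at most `N`, hence is a power of `s`;
the single `t` of the commutator cannot supply the two in the target. -/
theorem coeff_engel_mul_eq_zero {s t : X} (hst : s ≠ t) {N : ℕ}
    {p : MonoidAlgebra (FreeAlgebra K X) (FreeMonoid X)} (hp : ∀ v, N < v.length → p.coeff v = 0)
    {u : FreeMonoid X} (hu : t ∈ FreeMonoid.toList u) (n : ℕ) :
    (wordEmbedding K X (engelCommutator K s t n) * p).coeff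
      (u * FreeMonoid.of t * FreeMonoid.of s ^ N) = 0 := by
  have h := wordEmbedding_engel_mem (K := K) s t n
  generalize wordEmbedding K X (engelCommutator K s t n) = q at h
  induction h using Submodule.span_induction with
  | mem q hq =>
    obtain ⟨i, j, rfl⟩ := hq
    rw [← Submodule.mem_bot K]
    refine coeff_single_mul_mem _ fun v hv => ?_
    rw [Submodule.mem_bot]
    refine hp v (not_le.1 fun hle => ?_)
    classical
    have e := congrArg FreeMonoid.toList hv
    simp only [FreeMonoid.toList_mul, FreeMonoid.toList_of, toList_of_pow] at e
    have hsuf : FreeMonoid.toList v <:+ List.replicate N s := by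
      refine List.suffix_of_suffix_length_le (l₃ := FreeMonoid.toList u ++ [t] ++
        List.replicate N s) (e ▸ List.suffix_append _ _) (List.suffix_append _ _) ?_
      rw [List.length_replicate]
      exact hle
    have hcount := congrArg (List.count t) e
    have hu' := List.count_pos_iff.2 hu
    simp only [List.count_append, List.count_replicate, List.count_singleton, beq_self_eq_true,
      beq_iff_eq, hst, if_true, if_false] at hcount
    have hv' : t ∈ FreeMonoid.toList v := List.count_pos_iff.1 (by omega)
    exact hst (List.eq_of_mem_replicate (hsuf.mem hv')).symm
  | zero => simp
  | add p q _ _ hp hq => rw [add_mul, coeff_add, Finsupp.add_apply, hp, hq, add_zero]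
  | smul r p _ hp => rw [smul_mul_assoc, coeff_smul, Finsupp.smul_apply, hp, smul_zero]

theorem exists_length_bound (p : MonoidAlgebra (FreeAlgebra K X) (FreeMonoid X)) :
    ∃ N, ∀ v, N < v.length → p.coeff v = 0 := by
  refine ⟨p.coeff.support.sup FreeMonoid.length, fun v hv => ?_⟩
  by_contra h
  exact absurd (Finset.le_sup (f := FreeMonoid.length) (Finsupp.mem_support_iff.2 h)) (not_le.2 hv)

/-- If the brackets of `f` with two generators `s ≠ t` have high weight, then so have the
coefficients of the coproduct of `f` at all words that contain `t`. -/
theorem coeff_wordCoproduct_mem_of_bracket_mem {s t : X} (hst : s ≠ t) {k : ℕ}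
    {f : FreeAlgebra K X}
    (hs : ⁅f, FreeAlgebra.ι K s⁆ ∈ weightSpan K (FreeAlgebra.ι K : X → FreeAlgebra K X) k)
    (ht : ⁅f, FreeAlgebra.ι K t⁆ ∈ weightSpan K (FreeAlgebra.ι K : X → FreeAlgebra K X) k)
    {u : FreeMonoid X} (hu : t ∈ FreeMonoid.toList u) :
    (wordCoproduct K X f).coeff u ∈
      weightSpan K (FreeAlgebra.ι K : X → FreeAlgebra K X) (k - u.length) := by
  obtain ⟨N, hN⟩ := exists_length_bound (wordCoproduct K X f)
  set w := engelCommutator K s t N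
  have hlen : (u * FreeMonoid.of t * FreeMonoid.of s ^ N).length = u.length + 1 + N := by
    rw [FreeMonoid.length_mul, FreeMonoid.length_mul, FreeMonoid.length_of]
    congr 1
    exact (congrArg List.length (toList_of_pow s N)).trans List.length_replicate
  have hz : (wordCoproduct K X f).coeff (u * FreeMonoid.of t * FreeMonoid.of s ^ N) = 0 :=
    hN _ (by rw [hlen]; omega)
  have e : (wordCoproduct K X ⁅f, w⁆).coeff (u * FreeMonoid.of t * FreeMonoid.of s ^ N) =
      (wordCoproduct K X f).coeff u := by
    have hΔ : wordCoproduct K X w = wordEmbedding K X w + single 1 w :=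
      (isLieMonomial_engelCommutator s t N).wordCoproduct_eq
    rw [Ring.lie_def, map_sub (wordCoproduct K X), map_mul (wordCoproduct K X),
      map_mul (wordCoproduct K X), hΔ, mul_add, add_mul, coeff_sub,
      Finsupp.sub_apply, coeff_add, coeff_add, Finsupp.add_apply, Finsupp.add_apply,
      coeff_mul_engel hst, coeff_engel_mul_eq_zero hst hN hu, coeff_single_one_mul,
      coeff_mul_single_one, hz, zero_mul, mul_zero, add_zero, add_zero, sub_zero]
  -- The target word has length `u.length + 1 + N`, so from weight `k + N` exactly `k - u.length`
  -- survives.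
  rw [← e]
  refine weightSpan_antitone ?_
    (coeff_wordCoproduct_mem (bracket_engelCommutator_mem hs ht N) _)
  rw [hlen]
  omega

end Coproduct

/-! ### Recovering brackets from the coproduct -/

section Reconstruction

open MonoidAlgebra

variable {K X A : Type*} [CommRing K] [Ring A] [Algebra K A]

/-- The iterated adjoint action `[g_{i₁}, [g_{i₂}, …, [g_{i_k}, z]]]` of a word. -/
def adWord (g : X → A) (z : A) (u : FreeMonoid X) : A :=
  (FreeMonoid.toList u).foldr (fun i y => ⁅g i, y⁆) z

theorem adWord_one (g : X → A) (z : A) : adWord g z 1 = z := rfl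

theorem adWord_of_mul (g : X → A) (z : A) (i : X) (u : FreeMonoid X) :
    adWord g z (FreeMonoid.of i * u) = ⁅g i, adWord g z u⁆ := rfl

theorem adWord_mem {S : Subring A} {g : X → A} (hg : ∀ i, g i ∈ S) (z : A) (u : FreeMonoid X) :
    adWord g z u ∈ bracketPower S ⊤ u.length := by
  induction u using FreeMonoid.inductionOn' with
  | one => exact AddSubgroup.mem_top _
  | of_mul i u ih =>
    rw [adWord_of_mul, FreeMonoid.length_mul, FreeMonoid.length_of, add_comm 1]
    have e : ⁅g i, adWord g z u⁆ = -⁅adWord g z u, g i⁆ := by simp only [Ring.lie_def]; abel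
    rw [e]
    exact neg_mem (bracketPower_succ_mem ih (hg i))

/-- Evaluation of a polynomial in words with coefficients: a word acts on `z` by the adjoint
action, a coefficient by right multiplication. -/
noncomputable def adEval (θ : FreeAlgebra K X →ₐ[K] A) (z : A) :
    MonoidAlgebra (FreeAlgebra K X) (FreeMonoid X) →+ A where
  toFun p := p.coeff.sum fun u a => adWord (fun i => θ (FreeAlgebra.ι K i)) z u * θ a
  map_zero' := Finsupp.sum_zero_index
  map_add' p q := Finsupp.sum_add_index' (by simp) (by simp [mul_add])

theorem adEval_apply (θ : FreeAlgebra K X →ₐ[K] A) (z : A)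
    (p : MonoidAlgebra (FreeAlgebra K X) (FreeMonoid X)) : adEval θ z p =
      ∑ u ∈ p.coeff.support, adWord (fun i => θ (FreeAlgebra.ι K i)) z u * θ (p.coeff u) := rfl

theorem adEval_single (θ : FreeAlgebra K X →ₐ[K] A) (z : A) (u : FreeMonoid X)
    (a : FreeAlgebra K X) :
    adEval θ z (single u a) = adWord (fun i => θ (FreeAlgebra.ι K i)) z u * θ a := by
  change (single u a).coeff.sum
    (fun u a => adWord (fun i => θ (FreeAlgebra.ι K i)) z u * θ a) = _
  rw [coeff_single, Finsupp.sum_single_index (by rw [map_zero, mul_zero])]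

/-- For a generator this is $x(ya)=[x,y]a+y(xa)$ with $y=\mathrm{ad}_u(z)$: the two summands of its
coproduct. -/
theorem adEval_wordCoproduct_mul (θ : FreeAlgebra K X →ₐ[K] A) (z : A) (f : FreeAlgebra K X)
    (p : MonoidAlgebra (FreeAlgebra K X) (FreeMonoid X)) :
    adEval θ z (wordCoproduct K X f * p) = θ f * adEval θ z p := by
  induction f using FreeAlgebra.induction generalizing p with
  | grade0 r =>
    suffices h : (adEval θ z).comp (AddMonoidHom.mulLeft (wordCoproduct K X (algebraMap K _ r))) =
        (AddMonoidHom.mulLeft (θ (algebraMap K _ r))).comp (adEval θ z) from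
      DFunLike.congr_fun h p
    ext u a
    simp only [AddMonoidHom.comp_apply, AddMonoidHom.coe_mulLeft, AlgHom.commutes,
      singleAddHom_apply]
    rw [← Algebra.smul_def, smul_single, adEval_single, adEval_single, map_smul, mul_smul_comm,
      Algebra.smul_def]
  | grade1 i =>
    suffices h : (adEval θ z).comp (AddMonoidHom.mulLeft (wordCoproduct K X (FreeAlgebra.ι K i))) =
        (AddMonoidHom.mulLeft (θ (FreeAlgebra.ι K i))).comp (adEval θ z) from
      DFunLike.congr_fun h p
    ext u a
    simp [add_mul, adEval_single, adWord_of_mul, Ring.lie_def]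
    noncomm_ring
  | mul a b ha hb => rw [map_mul (wordCoproduct K X), mul_assoc, ha, hb, map_mul θ, mul_assoc]
  | add a b ha hb => rw [map_add, add_mul, map_add, ha, hb, map_add, add_mul]

/-- The whole sum is `θ f * z`; the empty word contributes `z * θ f`. -/
theorem bracket_eq_sum_adWord (θ : FreeAlgebra K X →ₐ[K] A) (z : A) (f : FreeAlgebra K X)
    [DecidableEq (FreeMonoid X)] :
    ⁅θ f, z⁆ = ∑ u ∈ (wordCoproduct K X f).coeff.support.erase 1,
      adWord (fun i => θ (FreeAlgebra.ι K i)) z u * θ ((wordCoproduct K X f).coeff u) := by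
  have h := adEval_wordCoproduct_mul θ z f 1
  rw [mul_one, one_def, adEval_single, adWord_one, map_one, mul_one] at h
  rw [Ring.lie_def, ← h, adEval_apply, sub_eq_iff_eq_add]
  by_cases h1 : (1 : FreeMonoid X) ∈ (wordCoproduct K X f).coeff.support
  · rw [← Finset.sum_erase_add _ _ h1, coeff_wordCoproduct_one, adWord_one]
  · have h0 := Finsupp.notMem_support_iff.1 h1
    rw [coeff_wordCoproduct_one] at h0
    rw [Finset.erase_eq_of_notMem h1, show z * θ f = 0 by rw [h0, map_zero, mul_zero], add_zero]

variable {S : Subring A}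

theorem mul_mem_bracketIdeal_add (hS : ∀ m, BracketProduct S m) {k m : ℕ} {a c : A}
    (ha : a ∈ bracketIdeal S k) (hc : c ∈ bracketPower S S.toAddSubgroup m) :
    a * c ∈ bracketIdeal S (k + m) := by
  induction ha using Submodule.span_induction with
  | mem b hb => exact hS m k b hb c hc
  | zero => simp
  | add x y _ _ hx hy => rw [add_mul]; exact add_mem hx hy
  | smul r x _ hx => rw [smul_eq_mul, mul_assoc]; exact Ideal.mul_mem_left _ _ hx

theorem IsLieMonomial.map_mem {θ : FreeAlgebra K X →ₐ[K] A} (hθ : ∀ i, θ (FreeAlgebra.ι K i) ∈ S)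
    {m : ℕ} {a : FreeAlgebra K X} (ha : IsLieMonomial (FreeAlgebra.ι K) m a) :
    θ a ∈ bracketPower S S.toAddSubgroup m := by
  induction ha with
  | gen i => exact hθ i
  | bracket i _ ih =>
    have := bracketPower_succ_mem ih (hθ i)
    rwa [Ring.lie_def, ← map_mul, ← map_mul, ← map_sub] at this

theorem IsProdMonomial.mul_map_mem (hS : ∀ m, BracketProduct S m) {θ : FreeAlgebra K X →ₐ[K] A}
    (hθ : ∀ i, θ (FreeAlgebra.ι K i) ∈ S) {j k : ℕ} {b : FreeAlgebra K X}
    (hb : IsProdMonomial (FreeAlgebra.ι K) j b) {a : A} (ha : a ∈ bracketIdeal S k) :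
    a * θ b ∈ bracketIdeal S (k + j) := by
  induction hb generalizing k a with
  | one => simpa using ha
  | mul h _ ih =>
    rw [map_mul, ← mul_assoc, ← add_assoc]
    exact ih (mul_mem_bracketIdeal_add hS ha (h.map_mem hθ))

theorem mul_map_mem_bracketIdeal (hS : ∀ m, BracketProduct S m) {θ : FreeAlgebra K X →ₐ[K] A}
    (hθ : ∀ i, θ (FreeAlgebra.ι K i) ∈ S) {j k : ℕ} {b : FreeAlgebra K X}
    (hb : b ∈ weightSpan K (FreeAlgebra.ι K) j) {a : A} (ha : a ∈ bracketIdeal S k) :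
    a * θ b ∈ bracketIdeal S (k + j) := by
  induction hb using Submodule.span_induction with
  | mem b hb =>
    obtain ⟨i, hi, hb⟩ := hb
    exact bracketIdeal_antitone (by omega) (hb.mul_map_mem hS hθ ha)
  | zero => simp
  | add p q _ _ hp hq => rw [map_add, mul_add]; exact add_mem hp hq
  | smul r p _ hp =>
    rw [map_smul, mul_smul_comm, Algebra.smul_def]
    exact Ideal.mul_mem_left _ _ hp

/-- An element of the free algebra of rank two which commutes with the generators modulo high
weight commutes with every element modulo high brackets. -/
theorem bracket_map_mem_bracketIdeal (h2 : IsUnit (2 : A)) 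
    (θ : FreeAlgebra K (Fin 2) →ₐ[K] A) {k : ℕ} {f : FreeAlgebra K (Fin 2)}
    (hf : ∀ i, ⁅f, FreeAlgebra.ι K i⁆ ∈
      weightSpan K (FreeAlgebra.ι K : Fin 2 → FreeAlgebra K (Fin 2)) k) (z : A) :
    ⁅θ f, z⁆ ∈ bracketIdeal
      (Algebra.adjoin K {θ (FreeAlgebra.ι K 0), θ (FreeAlgebra.ι K 1)}).toSubring k := by
  classical
  have hθ : ∀ i, θ (FreeAlgebra.ι K i) ∈
      (Algebra.adjoin K {θ (FreeAlgebra.ι K 0), θ (FreeAlgebra.ι K 1)}).toSubring := by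
    intro i
    refine Algebra.subset_adjoin ?_
    fin_cases i <;> simp
  rw [bracket_eq_sum_adWord]
  refine sum_mem fun u hu => ?_
  have hne : FreeMonoid.toList u ≠ [] := fun h => (Finset.mem_erase.1 hu).1 h
  obtain ⟨t, ht⟩ := List.exists_mem_of_ne_nil _ hne
  obtain ⟨s, hst⟩ := exists_ne t
  -- The weights `u.length` and `k - u.length` add up to at least `k`, also when the subtraction
  -- truncates.
  exact bracketIdeal_antitone (by omega)
    (mul_map_mem_bracketIdeal (bracketProduct_adjoin_pair _ _ h2) hθ
      (coeff_wordCoproduct_mem_of_bracket_mem hst (hf s) (hf t) ht)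
      (mem_bracketIdeal (adWord_mem hθ z u)))

end Reconstruction

/-! ### Exterior algebras as a model of $[a,b,c]=0$ -/

section Exterior

variable {K M : Type*} [CommRing K] [AddCommGroup M] [Module K M]

theorem ExteriorAlgebra.ι_mul_ι_eq_neg (v w : M) :
    ExteriorAlgebra.ι K v * ExteriorAlgebra.ι K w =
      -(ExteriorAlgebra.ι K w * ExteriorAlgebra.ι K v) :=
  eq_neg_of_add_eq_zero_left (ExteriorAlgebra.ι_add_mul_swap v w)

theorem ExteriorAlgebra.commute_of_mem_even {x : ExteriorAlgebra K M}
    (hx : x ∈ CliffordAlgebra.evenOdd (0 : QuadraticForm K M) 0) (y : ExteriorAlgebra K M) :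
    Commute x y := by
  have h : ∀ m : M, Commute x (ExteriorAlgebra.ι K m) := by
    intro m
    induction x, hx using CliffordAlgebra.even_induction with
    | algebraMap r => exact Algebra.commutes _ _
    | add x y hx hy h1 h2 => exact h1.add_left h2
    | ι_mul_ι_mul m₁ m₂ x hx ih =>
      refine Commute.mul_left ?_ ih
      change ExteriorAlgebra.ι K m₁ * ExteriorAlgebra.ι K m₂ * ExteriorAlgebra.ι K m =
        ExteriorAlgebra.ι K m * (ExteriorAlgebra.ι K m₁ * ExteriorAlgebra.ι K m₂)
      rw [mul_assoc, ι_mul_ι_eq_neg m₂ m, mul_neg, ← mul_assoc, ι_mul_ι_eq_neg m₁ m, neg_mul,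
        neg_neg, mul_assoc]
  induction y using ExteriorAlgebra.induction with
  | algebraMap r => exact (Algebra.commutes _ _).symm
  | ι m => exact h m
  | mul a b ha hb => exact ha.mul_right hb
  | add a b ha hb => exact ha.add_right hb

/-- Exterior algebras satisfy the identity `[a, b, c] = 0`. -/
theorem ExteriorAlgebra.bracket_bracket_eq_zero (a b c : ExteriorAlgebra K M) :
    ⁅⁅a, b⁆, c⁆ = 0 := by
  have hd : ∀ x : ExteriorAlgebra K M, ∃ e ∈ CliffordAlgebra.evenOdd (0 : QuadraticForm K M) 0,
      ∃ o ∈ CliffordAlgebra.evenOdd (0 : QuadraticForm K M) 1, e + o = x := fun x =>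
    Submodule.mem_sup.1
      ((CliffordAlgebra.evenOdd_isCompl (0 : QuadraticForm K M)).sup_eq_top ▸ Submodule.mem_top)
  have hodd : ∀ o ∈ CliffordAlgebra.evenOdd (0 : QuadraticForm K M) 1,
      ∀ o' ∈ CliffordAlgebra.evenOdd (0 : QuadraticForm K M) 1,
      o * o' ∈ CliffordAlgebra.evenOdd (0 : QuadraticForm K M) 0 := fun o ho o' ho' =>
    CliffordAlgebra.evenOdd_mul_le (0 : QuadraticForm K M) 1 1 (Submodule.mul_mem_mul ho ho')
  obtain ⟨e, he, o, ho, rfl⟩ := hd a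
  obtain ⟨e', he', o', ho', rfl⟩ := hd b
  have h1 : ⁅e + o, e' + o'⁆ = o * o' - o' * o := by
    rw [Ring.lie_def, mul_add, (commute_of_mem_even he' (e + o)).symm.eq, add_mul e o o',
      (commute_of_mem_even he o').eq]
    noncomm_ring
  rw [h1, Ring.lie_def]
  exact sub_eq_zero.2 (commute_of_mem_even (sub_mem (hodd _ ho _ ho') (hodd _ ho' _ ho)) c).eq

theorem ExteriorAlgebra.ι_single_mul_ne_zero [Nontrivial K] :
    ExteriorAlgebra.ι K (Pi.single 0 1 : Fin 4 → K) * ExteriorAlgebra.ι K (Pi.single 1 1) *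
      ExteriorAlgebra.ι K (Pi.single 2 1) * ExteriorAlgebra.ι K (Pi.single 3 1) ≠ 0 := by
  intro h
  -- The determinant in degree 4, zero elsewhere, gives a functional with value 1 on the product.
  let d : ∀ i, (Fin 4 → K) [⋀^Fin i]→ₗ[K] K := fun i =>
    if hi : 4 = i then hi ▸ Matrix.detRowAlternating else 0
  have := ExteriorAlgebra.liftAlternating_apply_ιMulti d (fun i : Fin 4 => (Pi.single i 1 : Fin 4 → K))
  rw [ExteriorAlgebra.ιMulti_apply] at this
  simp only [List.ofFn_succ, List.ofFn_zero, List.prod_cons, List.prod_nil, mul_one] at this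
  rw [← mul_assoc, ← mul_assoc] at this
  erw [h] at this
  rw [map_zero] at this
  have h1 : d 4 (fun i : Fin 4 => (Pi.single i 1 : Fin 4 → K)) = 1 := by
    change Matrix.det (fun i : Fin 4 => (Pi.single i 1 : Fin 4 → K)) = 1
    rw [← Matrix.det_one (n := Fin 4)]
    congr 1
    ext i j
    simp [Matrix.one_apply, Pi.single_apply, eq_comm]
  exact zero_ne_one (this.trans h1)

end Exterior

/-! ### Transfer to the relatively free algebras -/

section RelFree

variable {K : Type*} [CommRing K]

theorem leftNormedCommutator_eq_iterBracket {A : Type*} [Ring A] (v : ℕ → A) (k : ℕ) :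
    leftNormedCommutator v (k + 1) = iterBracket (v 0) ((List.range k).map fun i => v (i + 1)) := by
  induction k with
  | zero => rfl
  | succ k ih =>
    rw [leftNormedCommutator_succ, ih, List.range_succ, List.map_append, iterBracket_append]
    rfl

theorem iterBracket_mem_lieNilpotentTIdeal (c : FreeAlgebra K ℕ) (ds : List (FreeAlgebra K ℕ)) :
    iterBracket c ds ∈ lieNilpotentTIdeal K (ds.length + 1) := by
  have h := leftNormedCommutator_mem_lieNilpotentTIdeal (ds.length + 1)
    (fun i => (c :: ds).getD i 0)
  rw [leftNormedCommutator_eq_iterBracket] at h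
  convert h using 1
  refine congrArg (iterBracket c) (List.ext_getElem (by simp) fun i h1 h2 => ?_)
  simp [h1]

theorem bracketIdeal_le_lieNilpotentTIdeal (S : Subring (FreeAlgebra K ℕ)) {k : ℕ}
    {a : FreeAlgebra K ℕ} (ha : a ∈ bracketIdeal S k) : a ∈ lieNilpotentTIdeal K (k + 1) := by
  induction ha using Submodule.span_induction with
  | mem b hb =>
    refine exists_iterBracket_of_mem (p := (· ∈ lieNilpotentTIdeal K (k + 1))) (zero_mem _)
      (fun _ _ => add_mem) (fun _ => neg_mem) (fun c _ ds _ hl => ?_) hb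
    rw [← hl]
    exact iterBracket_mem_lieNilpotentTIdeal c ds
  | zero => exact zero_mem _
  | add x y _ _ hx hy => exact add_mem hx hy
  | smul r x _ hx => exact TwoSidedIdeal.mul_mem_left _ _ _ hx

/-- The projection of the free algebra onto `F^(n)`. -/
def relFreeProj (K : Type*) [CommRing K] (n : ℕ) : FreeAlgebra K ℕ →ₐ[K] RelFree K n :=
  (lieNilpotentTIdeal K n).ringCon.mkₐ (α := K)

theorem relFreeProj_surjective (n : ℕ) : Function.Surjective (relFreeProj K n) :=
  RingCon.mkₐ_surjective _

theorem relFreeProj_eq_zero_iff {n : ℕ} {a : FreeAlgebra K ℕ} :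
    relFreeProj K n a = 0 ↔ a ∈ lieNilpotentTIdeal K n := by
  rw [TwoSidedIdeal.mem_iff]
  exact RingCon.eq _

theorem map_bracket {A B : Type*} [Ring A] [Ring B] [Algebra K A] [Algebra K B] (φ : A →ₐ[K] B)
    (a b : A) : φ ⁅a, b⁆ = ⁅φ a, φ b⁆ := by
  simp only [Ring.lie_def, map_sub, map_mul]

theorem relFreeRank_eq_map (n r : ℕ) : relFreeRank K n r =
    (Algebra.adjoin K (FreeAlgebra.ι K '' {i | i < r})).map (relFreeProj K n) := by
  rw [AlgHom.map_adjoin, Set.image_image]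
  rfl

theorem relFreeGen_mem {n r i : ℕ} (h : i < r) : relFreeGen K n i ∈ relFreeRank K n r :=
  Algebra.subset_adjoin ⟨i, h, rfl⟩

theorem mem_centerIn_iff {A : Type*} [Ring A] [Algebra K A] {B : Subalgebra K A} {a : A} :
    a ∈ centerIn B ↔ a ∈ B ∧ ∀ b ∈ B, b * a = a * b := by
  constructor
  · rintro ⟨⟨a, ha⟩, hc, rfl⟩
    exact ⟨ha, fun b hb => congrArg Subtype.val (Subalgebra.mem_center_iff.1 hc ⟨b, hb⟩)⟩
  · rintro ⟨ha, h⟩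
    exact ⟨⟨a, ha⟩, Subalgebra.mem_center_iff.2 fun b => Subtype.ext (h b b.2), rfl⟩

theorem inf_center_le_centerIn {A : Type*} [Ring A] [Algebra K A] (B : Subalgebra K A) :
    B ⊓ Subalgebra.center K A ≤ centerIn B := fun _ ha =>
  mem_centerIn_iff.2 ⟨ha.1, fun b _ => Subalgebra.mem_center_iff.1 ha.2 b⟩

/-- The inclusion of the free algebra of rank two. -/
def freeInclTwo (K : Type*) [CommRing K] : FreeAlgebra K (Fin 2) →ₐ[K] FreeAlgebra K ℕ :=
  FreeAlgebra.lift K fun i => FreeAlgebra.ι K (i : ℕ)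

/-- The retraction onto the free algebra of rank two. -/
def freeRetrTwo (K : Type*) [CommRing K] : FreeAlgebra K ℕ →ₐ[K] FreeAlgebra K (Fin 2) :=
  FreeAlgebra.lift K fun i => if h : i < 2 then FreeAlgebra.ι K ⟨i, h⟩ else 0

theorem freeRetrTwo_freeInclTwo (f : FreeAlgebra K (Fin 2)) :
    freeRetrTwo K (freeInclTwo K f) = f := by
  suffices h : (freeRetrTwo K).comp (freeInclTwo K) = AlgHom.id K _ from DFunLike.congr_fun h f
  ext i
  change freeRetrTwo K (freeInclTwo K (FreeAlgebra.ι K i)) = FreeAlgebra.ι K i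
  rw [freeInclTwo, FreeAlgebra.lift_ι_apply, freeRetrTwo, FreeAlgebra.lift_ι_apply, dif_pos i.2]

theorem freeInclTwo_ι (i : Fin 2) :
    freeInclTwo K (FreeAlgebra.ι K i) = FreeAlgebra.ι K (i : ℕ) :=
  FreeAlgebra.lift_ι_apply _ _

theorem mem_range_freeInclTwo {a : FreeAlgebra K ℕ}
    (ha : a ∈ Algebra.adjoin K (FreeAlgebra.ι K '' {i | i < 2})) :
    ∃ f, freeInclTwo K f = a := by
  refine (Algebra.adjoin_le (S := (freeInclTwo K).range) ?_) ha
  rintro _ ⟨i, hi, rfl⟩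
  exact ⟨FreeAlgebra.ι K ⟨i, hi⟩, freeInclTwo_ι _⟩

theorem centerIn_relFreeRank_two_le (h2 : IsUnit (2 : K)) (k : ℕ) :
    centerIn (relFreeRank K (k + 1) 2) ≤ Subalgebra.center K (RelFree K (k + 1)) := by
  intro a ha
  obtain ⟨haB, hcomm⟩ := mem_centerIn_iff.1 ha
  rw [relFreeRank_eq_map] at haB
  obtain ⟨a, haA, rfl⟩ := haB
  obtain ⟨f, rfl⟩ := mem_range_freeInclTwo haA
  have hf : ∀ i : Fin 2, ⁅f, FreeAlgebra.ι K i⁆ ∈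
      weightSpan K (FreeAlgebra.ι K : Fin 2 → FreeAlgebra K (Fin 2)) k := by
    intro i
    have h : ⁅freeInclTwo K f, freeInclTwo K (FreeAlgebra.ι K i)⁆ ∈
        lieNilpotentTIdeal K (k + 1) := by
      rw [← relFreeProj_eq_zero_iff, map_bracket, Ring.lie_def, sub_eq_zero, freeInclTwo_ι]
      exact (hcomm _ (relFreeGen_mem i.2)).symm
    -- Retracting puts the brackets into the weight filtration on two generators only, where `Fin 2`
    -- supplies the second letter.
    have := map_mem_weightSpan (freeRetrTwo K) h
    rwa [map_bracket, freeRetrTwo_freeInclTwo, freeRetrTwo_freeInclTwo] at this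
  have h2' : IsUnit (2 : FreeAlgebra K ℕ) := by
    have := h2.map (algebraMap K (FreeAlgebra K ℕ))
    rwa [map_ofNat] at this
  refine Subalgebra.mem_center_iff.2 fun b => ?_
  obtain ⟨z, rfl⟩ := relFreeProj_surjective (k + 1) b
  have h := bracketIdeal_le_lieNilpotentTIdeal _
    (bracket_map_mem_bracketIdeal h2' (freeInclTwo K) hf z)
  rw [← relFreeProj_eq_zero_iff, map_bracket, Ring.lie_def, sub_eq_zero] at h
  exact h.symm

/-! ### The rank three counterexample -/

theorem relFree_three_bracket (a b c : RelFree K 3) : ⁅⁅a, b⁆, c⁆ = 0 := by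
  obtain ⟨a, rfl⟩ := relFreeProj_surjective 3 a
  obtain ⟨b, rfl⟩ := relFreeProj_surjective 3 b
  obtain ⟨c, rfl⟩ := relFreeProj_surjective 3 c
  rw [← map_bracket, ← map_bracket, relFreeProj_eq_zero_iff]
  exact iterBracket_mem_lieNilpotentTIdeal a [b, c]

theorem bracket_mul_bracket_eq_zero {A : Type*} [Ring A] (h : ∀ a b c : A, ⁅⁅a, b⁆, c⁆ = 0)
    (a b c : A) : ⁅a, b⁆ * ⁅c, b⁆ = 0 := by
  have e : ⁅⁅a, b * c⁆, b⁆ = ⁅⁅a, b⁆, b⁆ * c + ⁅a, b⁆ * ⁅c, b⁆ + b * ⁅⁅a, c⁆, b⁆ := by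
    simp only [Ring.lie_def]; noncomm_ring
  simpa [h] using e.symm

theorem bracket_mul_gen_mem_centerIn :
    leftNormedCommutator (relFreeGen K 3) 2 * relFreeGen K 3 2 ∈
      centerIn (relFreeRank K 3 3) := by
  change ⁅relFreeGen K 3 0, relFreeGen K 3 1⁆ * relFreeGen K 3 2 ∈ _
  have h0 : relFreeGen K 3 0 ∈ relFreeRank K 3 3 := relFreeGen_mem (by norm_num)
  have h1 : relFreeGen K 3 1 ∈ relFreeRank K 3 3 := relFreeGen_mem (by norm_num)
  have h2 : relFreeGen K 3 2 ∈ relFreeRank K 3 3 := relFreeGen_mem (by norm_num)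
  refine mem_centerIn_iff.2 ⟨mul_mem (sub_mem (mul_mem h0 h1) (mul_mem h1 h0)) h2, ?_⟩
  suffices h : relFreeRank K 3 3 ≤ Subalgebra.centralizer K
      {⁅relFreeGen K 3 0, relFreeGen K 3 1⁆ * relFreeGen K 3 2} from fun b hb =>
    (Subalgebra.mem_centralizer_iff K |>.1 (h hb) _ rfl).symm
  refine Algebra.adjoin_le ?_
  rintro _ ⟨i, hi, rfl⟩
  refine (Subalgebra.mem_centralizer_iff K).2 ?_
  rintro _ rfl
  -- What remains is $[x_1,x_2][x_3,x_i]$, which vanishes since $x_i$ occurs in both brackets or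
  -- $i=3$.
  rw [← sub_eq_zero, ← Ring.lie_def, mul_bracket, relFree_three_bracket, zero_mul, add_zero]
  have hi' : i < 3 := hi
  have key := bracket_mul_bracket_eq_zero (relFree_three_bracket (K := K))
  interval_cases i
  · rw [show ⁅relFreeGen K 3 0, relFreeGen K 3 1⁆ = -⁅relFreeGen K 3 1, relFreeGen K 3 0⁆ by
      simp only [Ring.lie_def]; abel, neg_mul, key, neg_zero]
  · exact key _ _ _
  · rw [Ring.lie_def (relFreeGen K 3 2), sub_self, mul_zero]

theorem bracket_mul_gen_notMem_center [Nontrivial K] (h2 : IsUnit (2 : K)) :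
    leftNormedCommutator (relFreeGen K 3) 2 * relFreeGen K 3 2 ∉
      Subalgebra.center K (RelFree K 3) := by
  intro h
  let e : Fin 4 → ExteriorAlgebra K (Fin 4 → K) := fun i => ExteriorAlgebra.ι K (Pi.single i 1)
  have h3 : ⁅⁅FreeAlgebra.ι K 0, FreeAlgebra.ι K 1⁆ * FreeAlgebra.ι K 2, FreeAlgebra.ι K 3⁆ ∈
      lieNilpotentTIdeal K 3 := by
    rw [← relFreeProj_eq_zero_iff, map_bracket, map_mul, map_bracket, Ring.lie_def, sub_eq_zero]
    exact (Subalgebra.mem_center_iff.1 h (relFreeGen K 3 3)).symm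
  have h4 := map_mem_of_mem_lieNilpotentTIdeal (⊥ : TwoSidedIdeal (ExteriorAlgebra K (Fin 4 → K)))
    (fun v => (TwoSidedIdeal.mem_bot _).2 (ExteriorAlgebra.bracket_bracket_eq_zero _ _ _))
    (FreeAlgebra.lift K fun i : ℕ => e (Fin.ofNat 4 i)) h3
  rw [TwoSidedIdeal.mem_bot, map_bracket, map_mul, map_bracket] at h4
  simp only [FreeAlgebra.lift_ι_apply] at h4
  change ⁅⁅e 0, e 1⁆ * e 2, e 3⁆ = 0 at h4
  have swap : ∀ i j, e i * e j = -(e j * e i) := fun i j => ExteriorAlgebra.ι_mul_ι_eq_neg _ _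
  have h5 : ⁅⁅e 0, e 1⁆ * e 2, e 3⁆ = (4 : K) • (e 0 * e 1 * e 2 * e 3) := by
    have h6 : e 3 * (e 0 * e 1 * e 2) = -(e 0 * e 1 * e 2 * e 3) := by
      rw [← mul_assoc, ← mul_assoc, swap 3 0, neg_mul, neg_mul, mul_assoc (e 0), swap 3 1,
        mul_neg, neg_mul, neg_neg, mul_assoc, mul_assoc (e 1), swap 3 2]
      noncomm_ring
    rw [Ring.lie_def, Ring.lie_def, swap 1 0, sub_neg_eq_add, add_mul, add_mul, mul_add, h6]
    module
  have h7 : IsUnit (4 : K) := by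
    rw [show (4 : K) = 2 * 2 by norm_num]
    exact h2.mul h2
  rw [h5, h7.smul_eq_zero] at h4
  exact ExteriorAlgebra.ι_single_mul_ne_zero h4

end RelFree

theorem mainTheorem5 (K : Type*) [Field K] [Infinite K]
    (h2 : ringChar K ≠ 2) (h3 : ringChar K ≠ 3) :
    (∀ n : ℕ, 3 ≤ n →
      centerIn (relFreeRank K n 2) =
        relFreeRank K n 2 ⊓ Subalgebra.center K (RelFree K n)) ∧
    (centerIn (relFreeRank K 3 3) ≠
        relFreeRank K 3 3 ⊓ Subalgebra.center K (RelFree K 3) ∧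
      leftNormedCommutator (relFreeGen K 3) 2 * relFreeGen K 3 2 ∈
        centerIn (relFreeRank K 3 3) ∧
      leftNormedCommutator (relFreeGen K 3) 2 * relFreeGen K 3 2 ∉
        Subalgebra.center K (RelFree K 3)) := by
  have h2' : IsUnit (2 : K) := IsUnit.mk0 2 (Ring.two_ne_zero h2)
  refine ⟨fun n hn => ?_, ?_, bracket_mul_gen_mem_centerIn, bracket_mul_gen_notMem_center h2'⟩
  · obtain ⟨k, rfl⟩ : ∃ k, n = k + 1 := ⟨n - 1, by omega⟩
    exact le_antisymm
      (fun a ha => ⟨(mem_centerIn_iff.1 ha).1,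
        centerIn_relFreeRank_two_le h2' k ha⟩)
      (inf_center_le_centerIn _)
  · intro h
    exact bracket_mul_gen_notMem_center h2' (h ▸ bracket_mul_gen_mem_centerIn (K := K)).2
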